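/- Let $H$ be a separable infinite-dimensional complex Hilbert space and let $T$ be a bounded linear operator on $H$. For a bounded operator $S$ on a Hilbert space $X$ let $N(S)$ and $R(S)$ be its kernel and range, $\alpha(S)=\dim N(S)$ and $\beta(S)=\dim X/R(S)$, both in $\{0,1,2,\dots,\infty\}$. Call $T$ upper semi-Browder if $R(T)$ is closed, $\alpha(T)<\infty$, and $N(T^k)=N(T^{k+1})$ for some integer $k\ge 0$. If $\alpha(T)$ or $\beta(T)$ is finite, put $\operatorname{ind}(T)=\alpha(T)-\beta(T)\in[-\infty,\infty]$, and let $s\_mul(T)=\lim_{k\to\infty}\beta(T^k)/k\in[0,\infty]$ when this limit exists. Then $T$ is upper semi-Browder if and only if there is an orthogonal decomposition $H=H_1\oplus H_2$ with respect to which $$T=\begin{pmatrix}T_1&T_{12}\\0&T_2\end{pmatrix},$$ where $\dim H_1<\infty$, $T_1$ is nilpotent, $T_2$ has a bounded left inverse on $H_2$, the limit $s\_mul(T)$ exists, and $$\beta(T_2)=s\_mul(T)=-\operatorname{ind}(T).$$ Moreover, for every orthogonal decomposition in which $T$ has this upper triangular form with $\dim H_1<\infty$, $T_1$ nilpotent and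 $T_2$ left invertible, the limit $s\_mul(T)$ exists and $\beta(T_2)=s\_mul(T)=-\operatorname{ind}(T)$. -/

import Mathlib

open Filter Topology
open scoped ENNReal

noncomputable section

namespace SemiBrowder

variable {X : Type*} [NormedAddCommGroup X] [InnerProductSpace ℂ X]

/-- `α(T) = dim N(T)`, a natural number or `∞`. -/
def nullity (T : X →L[ℂ] X) : ℕ∞ :=
  Cardinal.toENat (Module.rank ℂ (LinearMap.ker (T : X →ₗ[ℂ] X)))

/-- `β(T) = dim X / R(T)` (algebraic quotient), a natural number or `∞`. -/
def deficiency (T : X →L[ℂ] X) : ℕ∞ :=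
  Cardinal.toENat (Module.rank ℂ (X ⧸ LinearMap.range (T : X →ₗ[ℂ] X)))

/-- The ascent of `T`: the least `k` with `N(T^k) = N(T^(k+1))`, and `∞` if there is none. -/
def ascent (T : X →L[ℂ] X) : ℕ∞ :=
  ⨅ (k : ℕ) (_ : LinearMap.ker ((T ^ k : X →L[ℂ] X) : X →ₗ[ℂ] X)
    = LinearMap.ker ((T ^ (k + 1) : X →L[ℂ] X) : X →ₗ[ℂ] X)), (k : ℕ∞)

/-- `T` is upper semi-Fredholm: `R(T)` is closed and `α(T) < ∞`. -/
def IsUpperSemiFredholm (T : X →L[ℂ] X) : Prop :=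
  IsClosed (Set.range T) ∧ nullity T < ⊤

/-- `T` is upper semi-Browder: upper semi-Fredholm with finite ascent. -/
def IsUpperSemiBrowder (T : X →L[ℂ] X) : Prop :=
  IsUpperSemiFredholm T ∧ ascent T < ⊤

/-- `ind(T) = α(T) - β(T)` in `[-∞, ∞]`; it is meaningful when `α(T)` or `β(T)` is finite. -/
def index (T : X →L[ℂ] X) : EReal :=
  ((nullity T : ℝ≥0∞) : EReal) - ((deficiency T : ℝ≥0∞) : EReal)

/-- The shift Samuel multiplicity `lim β(T^k) / k` of `T` exists in `[0, ∞]` and equals `m`. -/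
def HasShiftSamuelMultiplicity (T : X →L[ℂ] X) (m : ℝ≥0∞) : Prop :=
  Tendsto (fun k : ℕ => (deficiency (T ^ k) : ℝ≥0∞) / (k : ℝ≥0∞)) atTop (𝓝 m)

/-- `T` has a left inverse among the bounded operators on `X`. -/
def IsLeftInvertible (T : X →L[ℂ] X) : Prop :=
  ∃ S : X →L[ℂ] X, S * T = 1

/-- With respect to `X = X₁ ⊕ X₂`, the operator `T` is the matrix `[[T₁, T₁₂], [0, T₂]]`. -/
def HasUpperTriangularForm (T : X →L[ℂ] X) (X₁ X₂ : Submodule ℂ X)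
    (T₁ : X₁ →L[ℂ] X₁) (T₁₂ : X₂ →L[ℂ] X₁) (T₂ : X₂ →L[ℂ] X₂) : Prop :=
  (∀ x : X₁, T (x : X) = (T₁ x : X)) ∧ ∀ y : X₂, T (y : X) = (T₁₂ y : X) + (T₂ y : X)

end SemiBrowder

end

namespace SemiBrowder

section Algebra

universe u v
variable {K : Type u} [Field K] {A V B : Type v}
  [AddCommGroup A] [Module K A] [AddCommGroup V] [Module K V] [AddCommGroup B] [Module K B]

/-! A triangular form makes `T₁`, `T`, `T₂` an endomorphism of the exact sequence `X₁ → X → X₂`. If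
`T₂` is injective, the connecting map of the snake lemma vanishes, so `α(T) = α(T₁)` and `β(T^k) =
β(T₁^k) + k β(T₂)`. As `dim X₁ < ∞`, the first summand is bounded in `k`, so dividing by `k` gives
the multiplicity; and `α(T₁) = β(T₁)`, so `k = 1` gives the index.

For existence, take `X₁ = N(T^k)` with `k` where the kernels stabilise: `T⁻¹(X₁) = X₁` makes the
compression to the orthogonal complement injective, and closedness of `R(T) + X₁` makes its range
closed. Conversely, `R(T)` is a closed space plus a finite-dimensional one, and the kernels
stabilise at `X₁`. -/

theorem rank_add_rank_of_exact {i : A →ₗ[K] V} {p : V →ₗ[K] B} (hi : Function.Injective i)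
    (hp : Function.Surjective p) (hip : Function.Exact i p) :
    Module.rank K A + Module.rank K B = Module.rank K V := by
  rw [← LinearMap.rank_range_add_rank_ker p, hip.linearMap_ker_eq, rank_range_of_injective i hi,
    LinearMap.range_eq_top.2 hp, rank_top, add_comm]

/-- For an endomorphism `f` of a short exact sequence `A → V → B` that is injective on `B`,
the codimensions of the ranges add up. -/
theorem rank_quotient_range_of_exact {i : A →ₗ[K] V} {p : V →ₗ[K] B} (hi : Function.Injective i)
    (hp : Function.Surjective p) (hip : Function.Exact i p)
    {fA : A →ₗ[K] A} {f : V →ₗ[K] V} {fB : B →ₗ[K] B}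
    (hA : ∀ x, f (i x) = i (fA x)) (hB : ∀ x, p (f x) = fB (p x)) (hinj : Function.Injective fB) :
    Module.rank K (A ⧸ LinearMap.range fA) + Module.rank K (B ⧸ LinearMap.range fB) =
      Module.rank K (V ⧸ LinearMap.range f) := by
  have hA' : LinearMap.range fA ≤ (LinearMap.range f).comap i := by
    rintro _ ⟨x, rfl⟩
    exact ⟨i x, hA x⟩
  have hB' : LinearMap.range f ≤ (LinearMap.range fB).comap p := by
    rintro _ ⟨x, rfl⟩
    exact ⟨p x, (hB x).symm⟩
  refine rank_add_rank_of_exact (i := Submodule.mapQ _ _ i hA') (p := Submodule.mapQ _ _ p hB')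
    ?_ ?_ ?_
  · rw [injective_iff_map_eq_zero]
    intro a
    obtain ⟨a, rfl⟩ := Submodule.Quotient.mk_surjective _ a
    rw [Submodule.mapQ_apply, Submodule.Quotient.mk_eq_zero, Submodule.Quotient.mk_eq_zero]
    rintro ⟨x, hx⟩
    -- The vanishing of the connecting map: injectivity of `fB` forces the preimage `x` into the
    -- image of `A`.
    have hpx : p x = 0 := hinj (by rw [← hB, hx, hip.apply_apply_eq_zero, map_zero])
    obtain ⟨y, rfl⟩ := (hip x).1 hpx
    exact ⟨y, hi (by rw [← hA, hx])⟩
  · intro b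
    obtain ⟨b, rfl⟩ := Submodule.Quotient.mk_surjective _ b
    obtain ⟨x, rfl⟩ := hp b
    exact ⟨Submodule.Quotient.mk x, rfl⟩
  · intro x
    obtain ⟨x, rfl⟩ := Submodule.Quotient.mk_surjective _ x
    rw [Submodule.mapQ_apply, Submodule.Quotient.mk_eq_zero]
    constructor
    · rintro ⟨b, hb⟩
      obtain ⟨y, rfl⟩ := hp b
      obtain ⟨a, ha⟩ := (hip (x - f y)).1 (by rw [map_sub, hB, hb, sub_self])
      refine ⟨Submodule.Quotient.mk a, ?_⟩
      rw [Submodule.mapQ_apply, ha, Submodule.Quotient.eq]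
      exact ⟨-y, by simp⟩
    · rintro ⟨a, ha⟩
      obtain ⟨a, rfl⟩ := Submodule.Quotient.mk_surjective _ a
      rw [Submodule.mapQ_apply, Submodule.Quotient.eq] at ha
      obtain ⟨y, hy⟩ := ha
      exact ⟨-p y, by rw [map_neg, ← hB, hy, map_sub, hip.apply_apply_eq_zero]; simp⟩

theorem rank_ker_of_exact {i : A →ₗ[K] V} {p : V →ₗ[K] B} (hi : Function.Injective i)
    (hip : Function.Exact i p) {fA : A →ₗ[K] A} {f : V →ₗ[K] V} {fB : B →ₗ[K] B}
    (hA : ∀ x, f (i x) = i (fA x)) (hB : ∀ x, p (f x) = fB (p x)) (hinj : Function.Injective fB) :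
    Module.rank K (LinearMap.ker f) = Module.rank K (LinearMap.ker fA) := by
  have : LinearMap.ker f = (LinearMap.ker fA).map i := by
    ext x
    constructor
    · intro hx
      obtain ⟨a, rfl⟩ := (hip x).1 (hinj (by rw [← hB, LinearMap.mem_ker.1 hx, map_zero, map_zero]))
      refine ⟨a, ?_, rfl⟩
      rw [LinearMap.mem_ker, hA] at hx
      exact hi (by rw [hx, map_zero])
    · rintro ⟨a, ha, rfl⟩
      rw [LinearMap.mem_ker, hA, LinearMap.mem_ker.1 ha, map_zero]
  rw [this]
  exact ((Submodule.equivMapOfInjective i hi _).rank_eq).symm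

/-- The sequence `V/R(f) → V/R(gf) → V/R(g)` is exact; its first map is induced by `g`, whose
injectivity it inherits. -/
theorem rank_quotient_range_comp {f g : V →ₗ[K] V} (hg : Function.Injective g) :
    Module.rank K (V ⧸ LinearMap.range f) + Module.rank K (V ⧸ LinearMap.range g) =
      Module.rank K (V ⧸ LinearMap.range (g ∘ₗ f)) := by
  have h₁ : LinearMap.range f ≤ (LinearMap.range (g ∘ₗ f)).comap g := by
    rintro _ ⟨x, rfl⟩
    exact ⟨x, rfl⟩
  have h₂ : LinearMap.range (g ∘ₗ f) ≤ LinearMap.range g := LinearMap.range_comp_le_range f g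
  refine rank_add_rank_of_exact (i := Submodule.mapQ _ _ g h₁)
    (p := Submodule.mapQ _ _ LinearMap.id h₂) ?_ ?_ ?_
  · rw [injective_iff_map_eq_zero]
    intro a
    obtain ⟨a, rfl⟩ := Submodule.Quotient.mk_surjective _ a
    rw [Submodule.mapQ_apply, Submodule.Quotient.mk_eq_zero, Submodule.Quotient.mk_eq_zero]
    rintro ⟨x, hx⟩
    exact ⟨x, hg hx⟩
  · intro b
    obtain ⟨b, rfl⟩ := Submodule.Quotient.mk_surjective _ b
    exact ⟨Submodule.Quotient.mk b, rfl⟩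
  · intro x
    obtain ⟨x, rfl⟩ := Submodule.Quotient.mk_surjective _ x
    rw [Submodule.mapQ_apply, Submodule.Quotient.mk_eq_zero]
    constructor
    · rintro ⟨y, hy⟩
      exact ⟨Submodule.Quotient.mk y, congrArg Submodule.Quotient.mk hy⟩
    · rintro ⟨a, ha⟩
      obtain ⟨a, rfl⟩ := Submodule.Quotient.mk_surjective _ a
      rw [Submodule.mapQ_apply, Submodule.Quotient.eq] at ha
      obtain ⟨y, hy⟩ := h₂ ha
      exact ⟨a - y, by rw [map_sub, hy]; simp⟩

theorem pow_apply_of_semiconj {i : A →ₗ[K] V} {fA : A →ₗ[K] A} {f : V →ₗ[K] V}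
    (h : ∀ x, f (i x) = i (fA x)) (k : ℕ) (x : A) : (f ^ k) (i x) = i ((fA ^ k) x) := by
  rw [Module.End.pow_apply, Module.End.pow_apply]
  exact ((show Function.Semiconj i fA f from fun y => (h y).symm).iterate_right k x).symm

/-- `f` maps `ker f^(k+1)` into `ker f^k`, and what it kills lies in `ker f`. -/
theorem finiteDimensional_ker_pow {f : V →ₗ[K] V} [FiniteDimensional K (LinearMap.ker f)] (k : ℕ) :
    FiniteDimensional K (LinearMap.ker (f ^ k)) := by
  induction k with
  | zero =>
    rw [pow_zero, Module.End.one_eq_id, LinearMap.ker_id]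
    infer_instance
  | succ k ih =>
    refine Module.Finite.iff_fg.2 (Submodule.fg_of_fg_map_of_fg_inf_ker f ?_ ?_)
    · refine Module.Finite.iff_fg.1 (Submodule.finiteDimensional_of_le (S₂ := LinearMap.ker (f ^ k)) ?_)
      rintro _ ⟨x, hx, rfl⟩
      rwa [LinearMap.mem_ker, ← Module.End.mul_apply, ← pow_succ]
    · exact Module.Finite.iff_fg.1 (Submodule.finiteDimensional_of_le inf_le_right)

end Algebra

/-! ### Operators and triangular forms -/

section Operators

variable {X : Type*} [NormedAddCommGroup X] [InnerProductSpace ℂ X]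

theorem nullity_lt_top_iff (T : X →L[ℂ] X) :
    nullity T < ⊤ ↔ FiniteDimensional ℂ (LinearMap.ker (T : X →ₗ[ℂ] X)) := by
  rw [nullity, Cardinal.toENat_lt_top, Module.rank_lt_aleph0_iff]

theorem ascent_lt_top_iff (T : X →L[ℂ] X) :
    ascent T < ⊤ ↔ ∃ k : ℕ, LinearMap.ker ((T : X →ₗ[ℂ] X) ^ k)
      = LinearMap.ker ((T : X →ₗ[ℂ] X) ^ (k + 1)) := by
  simp [ascent, iInf_lt_iff]

theorem nullity_eq_deficiency_of_finiteDimensional [FiniteDimensional ℂ X] (T : X →L[ℂ] X) :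
    nullity T = deficiency T := by
  rw [nullity, deficiency, ← Module.finrank_eq_rank, ← Module.finrank_eq_rank]
  have h₁ := LinearMap.finrank_range_add_finrank_ker (T : X →ₗ[ℂ] X)
  have h₂ := Submodule.finrank_quotient_add_finrank (LinearMap.range (T : X →ₗ[ℂ] X))
  congr 2
  omega

theorem deficiency_le_finrank [FiniteDimensional ℂ X] (T : X →L[ℂ] X) :
    deficiency T ≤ (Module.finrank ℂ X : ℕ∞) := by
  rw [deficiency, ← Module.finrank_eq_rank, Cardinal.toENat_nat]
  exact_mod_cast Submodule.finrank_quotient_le _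

theorem deficiency_pow_of_injective {T : X →L[ℂ] X} (hT : Function.Injective T) (k : ℕ) :
    deficiency (T ^ k) = k * deficiency T := by
  induction k with
  | zero =>
    rw [Nat.cast_zero, zero_mul, deficiency, ContinuousLinearMap.toLinearMap_pow, pow_zero,
      Module.End.one_eq_id, LinearMap.range_id]
    simp
  | succ k ih =>
    have := rank_quotient_range_comp (f := ((T ^ k : X →L[ℂ] X) : X →ₗ[ℂ] X))
      (g := (T : X →ₗ[ℂ] X)) hT
    rw [deficiency, pow_succ', ContinuousLinearMap.toLinearMap_mul, Module.End.mul_eq_comp, ← this,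
      map_add, Nat.cast_succ, add_mul, one_mul, ← ih, deficiency, deficiency]

theorem IsLeftInvertible.injective {T : X →L[ℂ] X} (hT : IsLeftInvertible T) :
    Function.Injective T := by
  obtain ⟨S, hS⟩ := hT
  exact Function.LeftInverse.injective (g := S) fun x => DFunLike.congr_fun hS x

theorem isLeftInvertible_of_injective_of_isClosed_range [CompleteSpace X] {T : X →L[ℂ] X}
    (hT : Function.Injective T) (hc : IsClosed (Set.range T)) : IsLeftInvertible T := by
  have : CompleteSpace (LinearMap.range (T : X →ₗ[ℂ] X)) := IsClosed.completeSpace_coe (s := Set.range T) (hs := hc)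
  obtain ⟨S, hS⟩ :=
    ContinuousLinearMap.HasLeftInverse.of_injective_of_isClosed_range_of_closedComplement_range hT hc
      ⟨Submodule.orthogonalProjectionOnto _,
        fun x => Submodule.orthogonalProjectionOnto_mem_subspace_eq_self x⟩
  exact ⟨S, ContinuousLinearMap.ext hS⟩

variable {X₁ X₂ : Submodule ℂ X} {T : X →L[ℂ] X} {T₁ : X₁ →L[ℂ] X₁} {T₁₂ : X₂ →L[ℂ] X₁}
  {T₂ : X₂ →L[ℂ] X₂}

theorem exact_subtype_projectionOnto (hc : IsCompl X₁ X₂) :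
    Function.Exact X₁.subtype (X₂.projectionOnto X₁ hc.symm) := by
  rw [LinearMap.exact_iff, Submodule.ker_projectionOnto, Submodule.range_subtype]

theorem HasUpperTriangularForm.projectionOnto_apply (h : HasUpperTriangularForm T X₁ X₂ T₁ T₁₂ T₂)
    (hc : IsCompl X₁ X₂) (x : X) :
    X₂.projectionOnto X₁ hc.symm (T x) = T₂ (X₂.projectionOnto X₁ hc.symm x) := by
  obtain ⟨a, ha, b, hb, rfl⟩ := Submodule.mem_sup.1 (hc.sup_eq_top ▸ Submodule.mem_top (x := x))
  lift a to X₁ using ha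
  lift b to X₂ using hb
  simp [h.1, h.2]

theorem HasUpperTriangularForm.pow_coe_left (h : HasUpperTriangularForm T X₁ X₂ T₁ T₁₂ T₂)
    (k : ℕ) (x : X₁) : (T ^ k) (x : X) = ((T₁ ^ k) x : X₁) := by
  have := pow_apply_of_semiconj (i := X₁.subtype) (fA := (T₁ : X₁ →ₗ[ℂ] X₁))
    (f := (T : X →ₗ[ℂ] X)) h.1 k x
  rwa [← ContinuousLinearMap.toLinearMap_pow, ← ContinuousLinearMap.toLinearMap_pow] at this

theorem HasUpperTriangularForm.projectionOnto_pow_apply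
    (h : HasUpperTriangularForm T X₁ X₂ T₁ T₁₂ T₂) (hc : IsCompl X₁ X₂) (k : ℕ) (x : X) :
    X₂.projectionOnto X₁ hc.symm ((T ^ k) x) = (T₂ ^ k) (X₂.projectionOnto X₁ hc.symm x) := by
  have := pow_apply_of_semiconj (i := X₂.projectionOnto X₁ hc.symm) (fA := (T : X →ₗ[ℂ] X))
    (f := (T₂ : X₂ →ₗ[ℂ] X₂)) (fun y => (h.projectionOnto_apply hc y).symm) k x
  rw [← ContinuousLinearMap.toLinearMap_pow, ← ContinuousLinearMap.toLinearMap_pow] at this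
  exact this.symm

theorem injective_pow (hT : Function.Injective T) (k : ℕ) : Function.Injective (T ^ k) := by
  rw [show ⇑(T ^ k) = T^[k] by
    rw [← ContinuousLinearMap.coe_coe, ContinuousLinearMap.toLinearMap_pow, Module.End.coe_pow]; rfl]
  exact hT.iterate k

theorem HasUpperTriangularForm.deficiency_pow (h : HasUpperTriangularForm T X₁ X₂ T₁ T₁₂ T₂)
    (hc : IsCompl X₁ X₂) (hT₂ : Function.Injective T₂) (k : ℕ) :
    deficiency (T ^ k) = deficiency (T₁ ^ k) + k * deficiency T₂ := by
  rw [← deficiency_pow_of_injective hT₂, deficiency, deficiency, deficiency, ← map_add]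
  congr 1
  exact (rank_quotient_range_of_exact X₁.subtype_injective
    (Submodule.projectionOnto_surjective hc.symm) (exact_subtype_projectionOnto hc)
    (h.pow_coe_left k) (h.projectionOnto_pow_apply hc k) (injective_pow hT₂ k)).symm

theorem HasUpperTriangularForm.nullity_eq (h : HasUpperTriangularForm T X₁ X₂ T₁ T₁₂ T₂)
    (hc : IsCompl X₁ X₂) (hT₂ : Function.Injective T₂) : nullity T = nullity T₁ :=
  congrArg Cardinal.toENat (rank_ker_of_exact X₁.subtype_injective
    (exact_subtype_projectionOnto hc) h.1 (h.projectionOnto_apply hc) hT₂)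

theorem HasUpperTriangularForm.hasShiftSamuelMultiplicity
    (h : HasUpperTriangularForm T X₁ X₂ T₁ T₁₂ T₂) (hc : IsCompl X₁ X₂)
    [FiniteDimensional ℂ X₁] (hT₂ : Function.Injective T₂) :
    HasShiftSamuelMultiplicity T (deficiency T₂ : ℝ≥0∞) := by
  have h₀ : Tendsto (fun k : ℕ => (deficiency (T₁ ^ k) : ℝ≥0∞) / (k : ℝ≥0∞)) atTop (𝓝 0) := by
    have hd : Tendsto (fun k : ℕ => (Module.finrank ℂ X₁ : ℝ≥0∞) / (k : ℝ≥0∞)) atTop (𝓝 0) := by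
      rw [← ENNReal.div_top (a := (Module.finrank ℂ X₁ : ℝ≥0∞))]
      exact ENNReal.Tendsto.const_div ENNReal.tendsto_nat_nhds_top
        (Or.inr (ENNReal.natCast_ne_top _))
    refine tendsto_of_tendsto_of_tendsto_of_le_of_le tendsto_const_nhds hd
      (fun _ => zero_le) fun k => ENNReal.div_le_div_right ?_ _
    simpa using ENat.toENNReal_le.2 (deficiency_le_finrank (T₁ ^ k))
  have h₁ := h₀.add_const (deficiency T₂ : ℝ≥0∞)
  rw [zero_add] at h₁
  refine h₁.congr' ?_
  -- Cancelling `k` in `k β(T₂) / k` requires `k ≠ 0`.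
  filter_upwards [eventually_ne_atTop 0] with k hk
  rw [h.deficiency_pow hc hT₂, ENat.toENNReal_add, ENat.toENNReal_mul, ENNReal.add_div,
    ENat.toENNReal_coe, mul_comm, ENNReal.mul_div_cancel_right (by exact_mod_cast hk)
      (ENNReal.natCast_ne_top k)]

theorem HasUpperTriangularForm.deficiency_eq_neg_index
    (h : HasUpperTriangularForm T X₁ X₂ T₁ T₁₂ T₂) (hc : IsCompl X₁ X₂)
    [FiniteDimensional ℂ X₁] (hT₂ : Function.Injective T₂) :
    ((deficiency T₂ : ℝ≥0∞) : EReal) = -index T := by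
  have h₁ := h.deficiency_pow hc hT₂ 1
  rw [pow_one, pow_one, Nat.cast_one, one_mul] at h₁
  rw [index, h.nullity_eq hc hT₂, h₁, nullity_eq_deficiency_of_finiteDimensional]
  -- Finiteness of `β(T₁)` is what allows it to cancel in `EReal`, even when `β(T₂) = ∞`.
  obtain ⟨n, hn⟩ := ENat.ne_top_iff_exists.1
    ((deficiency_le_finrank T₁).trans_lt (ENat.natCast_lt_top _)).ne
  rw [← hn]
  induction deficiency T₂ using ENat.recTopCoe with
  | top => simp
  | coe m =>
    have hcast : ∀ l : ℕ, ((l : ℝ≥0∞) : EReal) = ((l : ℝ) : EReal) := fun l => by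
      rw [← ENNReal.ofReal_natCast, EReal.coe_ennreal_ofReal, max_eq_left l.cast_nonneg]
    rw [ENat.toENNReal_add, ENat.toENNReal_coe, ENat.toENNReal_coe, EReal.coe_ennreal_add,
      hcast, hcast, ← EReal.coe_add, ← EReal.coe_sub, ← EReal.coe_neg]
    congr 1
    ring

theorem HasUpperTriangularForm.isUpperSemiBrowder [CompleteSpace X]
    (h : HasUpperTriangularForm T X₁ X₂ T₁ T₁₂ T₂) (ho : X₁ ⟂ X₂) (hc : IsCompl X₁ X₂)
    [FiniteDimensional ℂ X₁] (hT₁ : IsNilpotent T₁) (hT₂ : IsLeftInvertible T₂) :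
    IsUpperSemiBrowder T := by
  have hinj := hT₂.injective
  obtain rfl : X₂ = X₁ᗮ := by
    refine le_antisymm ho.ge fun x hx => ?_
    obtain ⟨a, ha, b, hb, rfl⟩ := Submodule.mem_sup.1 (hc.sup_eq_top ▸ Submodule.mem_top (x := x))
    have : a ∈ X₁ᗮ := (Submodule.add_mem_iff_left _ (ho.ge hb)).1 hx
    rw [(Submodule.disjoint_def.1 X₁.orthogonal_disjoint) a ha this, zero_add]
    exact hb
  refine ⟨⟨?_, ?_⟩, ?_⟩
  · have hr : ((LinearMap.range (T : X →ₗ[ℂ] X) : Submodule ℂ X) : Set X) = Set.range T := rfl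
    have hl : (T.comp X₁ᗮ.subtypeL).HasLeftInverse := by
      obtain ⟨S, hS⟩ := hT₂
      refine ⟨S.comp X₁ᗮ.orthogonalProjectionOnto, fun y => ?_⟩
      have hp : X₁ᗮ.orthogonalProjectionOnto (T y) = T₂ y := by
        rw [h.2, map_add, Submodule.orthogonalProjectionOnto_mem_subspace_eq_self,
          Submodule.orthogonalProjectionOnto_orthogonal_apply_eq_zero (T₁₂ y).2, zero_add]
      simp only [ContinuousLinearMap.comp_apply, Submodule.subtypeL_apply, hp]
      exact DFunLike.congr_fun hS y
    -- `T` has a left inverse on `X₁ᗮ`, so `T(X₁ᗮ)` is closed; adding the finite-dimensional `T(X₁)`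
    -- keeps it closed and gives `R(T)`.
    have hcl := Submodule.isClosed_sup_finiteDimensional
      (X₁ᗮ.map (T : X →ₗ[ℂ] X)) (X₁.map (T : X →ₗ[ℂ] X)) (by
        convert hl.isClosed_range using 1
        ext; simp)
    rwa [← Submodule.map_sup, sup_comm, hc.sup_eq_top, Submodule.map_top, hr] at hcl
  · rw [h.nullity_eq hc hinj, nullity_lt_top_iff]
    infer_instance
  · obtain ⟨n, hn⟩ := hT₁
    have key : ∀ k, n ≤ k → LinearMap.ker ((T : X →ₗ[ℂ] X) ^ k) = X₁ := by
      intro k hk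
      ext x
      rw [← ContinuousLinearMap.toLinearMap_pow]
      constructor
      · intro hx
        rw [LinearMap.mem_ker, ContinuousLinearMap.coe_coe] at hx
        have := h.projectionOnto_pow_apply hc k x
        rw [hx, map_zero] at this
        rw [← Submodule.projectionOnto_apply_eq_zero_iff hc.symm]
        exact injective_pow hinj k (by rw [← this, map_zero])
      · intro hx
        rw [LinearMap.mem_ker, ContinuousLinearMap.coe_coe, h.pow_coe_left k ⟨x, hx⟩,
          pow_eq_zero_of_le hk hn]
        rfl
    exact (ascent_lt_top_iff T).2 ⟨n, by rw [key n le_rfl, key (n + 1) n.le_succ]⟩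

theorem IsUpperSemiBrowder.exists_hasUpperTriangularForm [CompleteSpace X]
    (hT : IsUpperSemiBrowder T) :
    ∃ (X₁ X₂ : Submodule ℂ X) (T₁ : X₁ →L[ℂ] X₁) (T₁₂ : X₂ →L[ℂ] X₁) (T₂ : X₂ →L[ℂ] X₂),
      X₁ ⟂ X₂ ∧ IsCompl X₁ X₂ ∧ HasUpperTriangularForm T X₁ X₂ T₁ T₁₂ T₂ ∧
      FiniteDimensional ℂ X₁ ∧ IsNilpotent T₁ ∧ IsLeftInvertible T₂ := by
  obtain ⟨⟨hcl, hn⟩, ha⟩ := hT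
  rw [nullity_lt_top_iff] at hn
  obtain ⟨k, hk⟩ := (ascent_lt_top_iff T).1 ha
  obtain ⟨N, hN⟩ : ∃ N, N = LinearMap.ker ((T : X →ₗ[ℂ] X) ^ k) := ⟨_, rfl⟩
  have hfd : FiniteDimensional ℂ N := hN ▸ finiteDimensional_ker_pow k
  have hmem : ∀ x, x ∈ N ↔ (T ^ k) x = 0 := by
    intro x
    rw [hN, ← ContinuousLinearMap.toLinearMap_pow]
    rfl
  -- Invariance is the forward direction; the converse, which yields injectivity of `T₂`, is where
  -- stabilisation enters.
  have hmem' : ∀ x, x ∈ N ↔ T x ∈ N := by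
    intro x
    rw [hmem (T x), ← mul_apply_eq_comp, ← pow_succ, hN, hk,
      ← ContinuousLinearMap.toLinearMap_pow]
    rfl
  let T₁ : N →L[ℂ] N := (T.comp N.subtypeL).codRestrict N fun x => (hmem' x).1 x.2
  let T₁₂ : Nᗮ →L[ℂ] N := N.orthogonalProjectionOnto.comp (T.comp Nᗮ.subtypeL)
  let T₂ : Nᗮ →L[ℂ] Nᗮ := Nᗮ.orthogonalProjectionOnto.comp (T.comp Nᗮ.subtypeL)
  have hc : IsCompl N Nᗮ := N.isCompl_orthogonal
  have h : HasUpperTriangularForm T N Nᗮ T₁ T₁₂ T₂ := by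
    refine ⟨fun _ => rfl, fun y => ?_⟩
    exact (N.starProjection_add_starProjection_orthogonal (T y)).symm
  refine ⟨N, Nᗮ, T₁, T₁₂, T₂, N.isOrtho_orthogonal_right, hc, h, hfd, ⟨k, ?_⟩, ?_⟩
  · ext x
    rw [← h.pow_coe_left, (hmem _).1 x.2]
    rfl
  · refine isLeftInvertible_of_injective_of_isClosed_range ?_ ?_
    · rw [injective_iff_map_eq_zero]
      intro y hy
      have hyN : T y ∈ N := by
        rw [h.2, hy, Submodule.coe_zero, add_zero]
        exact (T₁₂ y).2
      exact Subtype.ext (Submodule.disjoint_def.1 hc.disjoint y ((hmem' y).2 hyN) y.2)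
    · have hs := Submodule.isClosed_sup_finiteDimensional (LinearMap.range (T : X →ₗ[ℂ] X)) N hcl
      -- Modulo `N`, `T` and `T₂` agree, so `R(T₂)` is the part of `R(T) + N` in `Nᗮ`.
      suffices Set.range T₂ = (fun z : Nᗮ => (z : X)) ⁻¹'
          ((LinearMap.range (T : X →ₗ[ℂ] X) ⊔ N : Submodule ℂ X) : Set X) by
        rw [this]
        exact hs.preimage continuous_subtype_val
      ext z
      constructor
      · rintro ⟨y, rfl⟩
        have : ((T₂ y : Nᗮ) : X) = T y + -(T₁₂ y : X) := by rw [h.2]; abel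
        change ((T₂ y : Nᗮ) : X) ∈ LinearMap.range (T : X →ₗ[ℂ] X) ⊔ N
        rw [this]
        exact Submodule.add_mem_sup ⟨y, rfl⟩ (neg_mem (T₁₂ y).2)
      · intro hz
        obtain ⟨_, ⟨x, rfl⟩, b, hb, hxb⟩ := Submodule.mem_sup.1 (SetLike.mem_coe.1 (Set.mem_preimage.1 hz))
        refine ⟨Nᗮ.projectionOnto N hc.symm x, ?_⟩
        rw [← h.projectionOnto_apply hc]
        have := congrArg (Nᗮ.projectionOnto N hc.symm) hxb
        rwa [map_add, Submodule.projectionOnto_apply_of_mem_right hc.symm hb, add_zero,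
          Submodule.projectionOnto_apply_left] at this

end Operators

end SemiBrowder

theorem proposition1p7 {H : Type*} [NormedAddCommGroup H] [InnerProductSpace ℂ H]
    [CompleteSpace H] [TopologicalSpace.SeparableSpace H] (hH : ¬ FiniteDimensional ℂ H)
    (T : H →L[ℂ] H) :
    (SemiBrowder.IsUpperSemiBrowder T ↔
      ∃ (H₁ H₂ : Submodule ℂ H) (T₁ : H₁ →L[ℂ] H₁) (T₁₂ : H₂ →L[ℂ] H₁) (T₂ : H₂ →L[ℂ] H₂),
        H₁ ⟂ H₂ ∧ IsCompl H₁ H₂ ∧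
        SemiBrowder.HasUpperTriangularForm T H₁ H₂ T₁ T₁₂ T₂ ∧
        FiniteDimensional ℂ H₁ ∧ IsNilpotent T₁ ∧ SemiBrowder.IsLeftInvertible T₂ ∧
        SemiBrowder.HasShiftSamuelMultiplicity T (SemiBrowder.deficiency T₂ : ℝ≥0∞) ∧
        ((SemiBrowder.deficiency T₂ : ℝ≥0∞) : EReal) = -SemiBrowder.index T) ∧
    (∀ (H₁ H₂ : Submodule ℂ H) (T₁ : H₁ →L[ℂ] H₁) (T₁₂ : H₂ →L[ℂ] H₁) (T₂ : H₂ →L[ℂ] H₂),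
        H₁ ⟂ H₂ → IsCompl H₁ H₂ →
        SemiBrowder.HasUpperTriangularForm T H₁ H₂ T₁ T₁₂ T₂ →
        FiniteDimensional ℂ H₁ → IsNilpotent T₁ → SemiBrowder.IsLeftInvertible T₂ →
        SemiBrowder.HasShiftSamuelMultiplicity T (SemiBrowder.deficiency T₂ : ℝ≥0∞) ∧
        ((SemiBrowder.deficiency T₂ : ℝ≥0∞) : EReal) = -SemiBrowder.index T) := by
  refine ⟨⟨fun hT => ?_, ?_⟩, ?_⟩
  · obtain ⟨H₁, H₂, T₁, T₁₂, T₂, ho, hc, h, hfd, hT₁, hT₂⟩ := hT.exists_hasUpperTriangularForm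
    exact ⟨H₁, H₂, T₁, T₁₂, T₂, ho, hc, h, hfd, hT₁, hT₂,
      h.hasShiftSamuelMultiplicity hc hT₂.injective, h.deficiency_eq_neg_index hc hT₂.injective⟩
  · rintro ⟨H₁, H₂, T₁, T₁₂, T₂, ho, hc, h, hfd, hT₁, hT₂, -⟩
    exact h.isUpperSemiBrowder ho hc hT₁ hT₂
  · intro H₁ H₂ T₁ T₁₂ T₂ _ hc h hfd _ hT₂
    exact ⟨h.hasShiftSamuelMultiplicity hc hT₂.injective,
      h.deficiency_eq_neg_index hc hT₂.injective⟩
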